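/- Conventions. For $n\in\mathbb N$ let $\mathcal P_n$ be the set of polynomials of degree at most $n$ all of whose coefficients lie in $\{-1,0,1\}$. Let $(\xi_k)_{k\in\mathbb Z}$ be independent random variables with $\mathbb P(\xi_k=1)=\mathbb P(\xi_k=-1)=1/2$. For $\lambda\in(0,1)$ and $I\subset\mathbb R_{>0}$ let $\mu_\lambda^I$ be the law of $\sum_{k\in\mathbb Z:\ \lambda^k\in I}\xi_k\lambda^k$; in particular $\mu_\lambda^{(\lambda^n,1]}$ is the law of the $n$-term truncation $\sum_{j=0}^{n-1}\xi_j\lambda^j$ of the Bernoulli convolution. For a bounded real random variable $X$ with law $\mu$ and for $r>0$ put \[ H(\mu;r)=\int_0^1 H\big(\lfloor X/r+t\rfloor\big)\,dt , \] where on the right $H(\cdot)$ is the Shannon entropy, with logarithms in base $2$, of a discrete random variable. Theorem. For every $\varepsilon>0$ there is a number $c>0$ such that the following holds for all $n$ large enough (depending only on $\varepsilon$). Let $0<\lambda\le 1-\varepsilon$. Suppose that $\eta\in\mathbb C$, $\eta\neq0$, is a root of a non-zero polynomial in $\mathcal P_n$ and that $|\lambda-\eta|<n^{-4n}$. Then \[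 H\big(\mu_\lambda^{(\lambda^n,1]};r\big)=n\qquad\text{for all } 0<r\le|\lambda-\eta|^{1/c}. \] -/

import Mathlib

open scoped ENNReal

noncomputable section

/-- The set `𝒫_d` of polynomials of degree at most `d` with all coefficients in `{-1, 0, 1}`
(the zero polynomial belongs to it). -/
def signPolynomials (d : ℕ) : Set (Polynomial ℤ) :=
  {P | P.natDegree ≤ d ∧ ∀ i, P.coeff i = -1 ∨ P.coeff i = 0 ∨ P.coeff i = 1}

/-- The law of a sequence, indexed by `ℤ`, of independent fair coin tosses. -/
def coinTosses : MeasureTheory.Measure (ℤ → Bool) :=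
  MeasureTheory.Measure.infinitePi fun _ : ℤ => (PMF.uniformOfFintype Bool).toMeasure

/-- The sign `1` or `-1` attached to a coin toss. Under `coinTosses`, the random variables
`ξ_k = coinSign (ω k)`, `k ∈ ℤ`, are independent and `P(ξ_k = 1) = P(ξ_k = -1) = 1/2`. -/
def coinSign (b : Bool) : ℝ := if b then 1 else -1

/-- The measure `μ_lam^I`: the law of the random variable `∑_{k ∈ ℤ : lam^k ∈ I} ξ_k lam^k`. -/
def bernoulliConvolution (lam : ℝ) (I : Set ℝ) : MeasureTheory.Measure ℝ :=
  coinTosses.map fun ω => ∑' k : {k : ℤ // lam ^ k ∈ I}, coinSign (ω k) * lam ^ (k : ℤ)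

/-- Shannon entropy, in base `2`, of a probability measure `ν` on `ℤ`:
`H(ν) = ∑_k -ν{k} log₂ ν{k}` with `0 log₂ 0 = 0`. All summands are nonnegative,
so the sum is taken in `[0, ∞]`. -/
def shannonEntropy (ν : MeasureTheory.Measure ℤ) : ℝ≥0∞ :=
  ∑' k : ℤ, ENNReal.ofReal (-(ν.real {k} * Real.logb 2 (ν.real {k})))

/-- Entropy at scale `r > 0` of a probability measure `μ` on `ℝ`: if `X` has law `μ`, this is
`H(μ; r) = ∫_0^1 H(⌊X / r + t⌋) dt`. -/
def entropyAtScale (μ : MeasureTheory.Measure ℝ) (r : ℝ) : ℝ≥0∞ :=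
  ∫⁻ t in Set.Icc (0 : ℝ) 1, shannonEntropy (μ.map fun x => ⌊x / r + t⌋)

end

/-! Full entropy at scale `r` follows once the `2 ^ n` signed sums are `r`-separated at `lam`. Half
the difference of two of them is `Q(lam)` for a nonzero sign polynomial `Q`, so with `δ = |lam - η|`
it suffices to prove `|Q(lam)| ≥ δ ^ (K + 1)` with `K` depending only on `ε`; then `c = 1 / (K +
1)`.

If `Q(η) ≠ 0`, Liouville's inequality (`one_le_norm_aeval_mul_of_isRoot`) keeps `Q(η)` far larger
than the variation of `Q` between `η` and `lam`. If `Q(η) = 0`, factor `Q` over its roots. Distinct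
roots in the unit disc are much further apart than `δ` (`one_le_norm_sub_mul_of_isRoot`), so every
nonzero root of modulus at most `1 - ε / 2` is at distance at least `δ` from `lam`, and by Jensen's
formula there are at most `K` of these (`exists_card_roots_filter_le`). All other factors are
bounded below by a constant `κ`, and together they cost at most `κ ^ n ≥ δ`.
`exists_norm_pow_le_norm_aeval` combines the two cases. -/

open scoped ENNReal

noncomputable section

open MeasureTheory Polynomial

/-! ### Entropy of separated signed sums -/

/-- The signed power sum `∑_{j < n} ± x ^ j` attached to a sign pattern. -/
def signSum (n : ℕ) (x : ℝ) (s : Fin n → Bool) : ℝ := ∑ j : Fin n, coinSign (s j) * x ^ (j : ℕ)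

lemma setOf_zpow_mem_Ioc {lam : ℝ} (h0 : 0 < lam) (h1 : lam < 1) (n : ℕ) :
    {k : ℤ | lam ^ k ∈ Set.Ioc (lam ^ n) 1} = {k : ℤ | 0 ≤ k ∧ k < n} := by
  ext k
  have h2 : lam ^ n < lam ^ k ↔ k < n := by
    rw [← zpow_natCast, zpow_lt_zpow_iff_right_of_lt_one₀ h0 h1]
  have h3 : lam ^ k ≤ 1 ↔ 0 ≤ k := by
    conv_lhs => rw [← zpow_zero lam]
    rw [zpow_le_zpow_iff_right_of_lt_one₀ h0 h1]
  simp [h2, h3, and_comm]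

/-- Nonnegative integers below `n`, as exponents `k : ℤ` with `lam ^ k ∈ (lam ^ n, 1]`. -/
def exponentEquiv {lam : ℝ} (h0 : 0 < lam) (h1 : lam < 1) (n : ℕ) :
    Fin n ≃ {k : ℤ // lam ^ k ∈ Set.Ioc (lam ^ n) 1} where
  toFun j := ⟨(j : ℕ), by
    have := (Set.ext_iff.1 (setOf_zpow_mem_Ioc h0 h1 n) ((j : ℕ) : ℤ)).2
      ⟨by positivity, by exact_mod_cast j.2⟩
    exact this⟩
  invFun k := ⟨(k : ℤ).toNat, by
    have := (Set.ext_iff.1 (setOf_zpow_mem_Ioc h0 h1 n) k).1 k.2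
    simp only [Set.mem_ofPred_eq] at this
    omega⟩
  left_inv j := by ext; simp
  right_inv k := by
    have := (Set.ext_iff.1 (setOf_zpow_mem_Ioc h0 h1 n) k).1 k.2
    simp only [Set.mem_ofPred_eq] at this
    ext; simp [this.1]

lemma tsum_eq_signSum {lam : ℝ} (h0 : 0 < lam) (h1 : lam < 1) (n : ℕ) (ω : ℤ → Bool) :
    ∑' k : {k : ℤ // lam ^ k ∈ Set.Ioc (lam ^ n) 1}, coinSign (ω k) * lam ^ (k : ℤ) =
      signSum n lam fun j => ω (j : ℕ) := by
  rw [← (exponentEquiv h0 h1 n).tsum_eq, tsum_fintype]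
  simp [exponentEquiv, signSum]

lemma coinTosses_cylinder (n : ℕ) (s : Fin n → Bool) :
    coinTosses {ω | (fun j : Fin n => ω (j : ℕ)) = s} = (2⁻¹ : ℝ≥0∞) ^ n := by
  classical
  set f : Fin n → ℤ := fun j => ((j : ℕ) : ℤ) with hf
  have hfi : Function.Injective f := fun i j h => by
    ext; simpa [hf] using h
  -- The side condition over all `j` with `f j = k` describes the factor at `k` without inverting
  -- `f`.
  have : {ω : ℤ → Bool | (fun j : Fin n => ω (j : ℕ)) = s} =
      Set.pi (Finset.univ.image f : Finset ℤ) fun k => {b | ∀ j, f j = k → b = s j} := by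
    ext ω
    simp only [Set.mem_ofPred_eq, Set.mem_pi, funext_iff]
    constructor
    · rintro h k - j rfl
      exact h j
    · intro h j
      exact h (f j) (by simp) j rfl
  rw [this, coinTosses, Measure.infinitePi_pi _ (fun _ _ => MeasurableSet.of_discrete),
    Finset.prod_image (fun _ _ _ _ h => hfi h)]
  have h2 : ∀ j : Fin n, {b | ∀ i, f i = f j → b = s i} = {s j} := by
    intro j
    ext b
    simp only [Set.mem_ofPred_eq, Set.mem_singleton_iff]
    exact ⟨fun h => h j rfl, fun h i hi => by rw [hfi hi, h]⟩
  simp [h2]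

lemma measurable_coordinates (n : ℕ) :
    Measurable fun (ω : ℤ → Bool) (j : Fin n) => ω (j : ℕ) := by
  fun_prop

/-- An injective image of `n` independent fair bits has entropy `n`. -/
lemma shannonEntropy_map_of_injective {n : ℕ} {φ : (Fin n → Bool) → ℤ}
    (hφ : Function.Injective φ) :
    shannonEntropy (coinTosses.map fun ω => φ fun j : Fin n => ω (j : ℕ)) = n := by
  have hm : Measurable fun ω : ℤ → Bool => φ fun j : Fin n => ω (j : ℕ) :=
    (measurable_of_countable φ).comp (measurable_coordinates n)
  have h1 : ∀ s, (coinTosses.map fun ω => φ fun j : Fin n => ω (j : ℕ)).real {φ s} =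
      (2⁻¹ : ℝ) ^ n := by
    intro s
    rw [measureReal_def, Measure.map_apply hm (measurableSet_singleton _)]
    have : (fun ω : ℤ → Bool => φ fun j : Fin n => ω (j : ℕ)) ⁻¹' {φ s} =
        {ω | (fun j : Fin n => ω (j : ℕ)) = s} := by
      ext ω
      simp [hφ.eq_iff]
    rw [this, coinTosses_cylinder]
    simp
  have h2 : ∀ k ∉ Set.range φ,
      (coinTosses.map fun ω => φ fun j : Fin n => ω (j : ℕ)).real {k} = 0 := by
    intro k hk
    rw [measureReal_def, Measure.map_apply hm (measurableSet_singleton _)]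
    have : (fun ω : ℤ → Bool => φ fun j : Fin n => ω (j : ℕ)) ⁻¹' {k} = ∅ := by
      ext ω
      simp only [Set.mem_preimage, Set.mem_singleton_iff, Set.mem_empty_iff_false, iff_false]
      exact fun h => hk ⟨_, h⟩
    simp [this]
  rw [shannonEntropy, ← hφ.tsum_eq, tsum_fintype]
  · simp_rw [h1]
    rw [Finset.sum_const, Finset.card_univ, Real.logb_pow, Real.logb_inv,
      Real.logb_self_eq_one (by norm_num)]
    simp only [Fintype.card_pi, Fintype.card_bool, Finset.prod_const, Finset.card_univ,
      Fintype.card_fin, nsmul_eq_mul]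
    rw [show ((2 ^ n : ℕ) : ℝ≥0∞) = ENNReal.ofReal (2 ^ n) by
        rw [ENNReal.ofReal_pow (by norm_num)]; simp,
      ← ENNReal.ofReal_mul (by positivity), ← ENNReal.ofReal_natCast n]
    congr 1
    field_simp
    rw [← mul_pow]; simp
  · intro k hk
    by_contra hk'
    exact hk (by simp [h2 k hk'])

/-- If the `2 ^ n` signed power sums are pairwise `r`-separated, the truncated Bernoulli
convolution has full entropy at scale `r`. -/
lemma entropyAtScale_eq_of_separated {lam r : ℝ} (h0 : 0 < lam) (h1 : lam < 1) (hr : 0 < r)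
    (n : ℕ) (hsep : ∀ s s' : Fin n → Bool, s ≠ s' → r ≤ |signSum n lam s - signSum n lam s'|) :
    entropyAtScale (bernoulliConvolution lam (Set.Ioc (lam ^ n) 1)) r = n := by
  have hb : bernoulliConvolution lam (Set.Ioc (lam ^ n) 1) =
      coinTosses.map fun ω => signSum n lam fun j : Fin n => ω (j : ℕ) := by
    simp only [bernoulliConvolution, tsum_eq_signSum h0 h1]
  have key : ∀ t : ℝ, shannonEntropy
      ((bernoulliConvolution lam (Set.Ioc (lam ^ n) 1)).map fun x => ⌊x / r + t⌋) = n := by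
    intro t
    have hm : Measurable fun x : ℝ => ⌊x / r + t⌋ := by fun_prop
    have hS : Measurable fun ω : ℤ → Bool => signSum n lam fun j : Fin n => ω (j : ℕ) :=
      (measurable_of_countable (signSum n lam)).comp (measurable_coordinates n)
    rw [hb, Measure.map_map hm hS]
    refine shannonEntropy_map_of_injective (φ := fun s => ⌊signSum n lam s / r + t⌋) ?_
    intro s s' h
    by_contra hne
    have h3 := Int.abs_sub_lt_one_of_floor_eq_floor h
    have h4 := hsep s s' hne
    rw [add_sub_add_right_eq_sub, ← sub_div, abs_div, abs_of_pos hr, div_lt_one hr] at h3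
    linarith
  simp [entropyAtScale, key]

/-! ### Liouville's inequality and root separation -/

lemma norm_pow_sub_pow_le {a b : ℂ} (ha : ‖a‖ ≤ 1) (hb : ‖b‖ ≤ 1) (k : ℕ) :
    ‖a ^ k - b ^ k‖ ≤ k * ‖a - b‖ := by
  induction k with
  | zero => simp
  | succ k ih =>
    have h : a ^ (k + 1) - b ^ (k + 1) = a * (a ^ k - b ^ k) + (a - b) * b ^ k := by ring
    rw [h]
    calc _ ≤ ‖a‖ * ‖a ^ k - b ^ k‖ + ‖a - b‖ * ‖b‖ ^ k := by
          refine (norm_add_le _ _).trans ?_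
          simp
      _ ≤ 1 * (k * ‖a - b‖) + ‖a - b‖ * 1 := by
          gcongr
          exact pow_le_one₀ (norm_nonneg _) hb
      _ = _ := by push_cast; ring

/-- Mahler's argument: subtracting row `j` from row `i` leaves entries `v i ^ k - v j ^ k`, which
carry the factor `‖v i - v j‖`. The Leibniz expansion then has `d!` terms. Row `i` fits the common
bound because `max 1 ‖v i‖ = 1`. -/
lemma norm_det_vandermonde_le {d : ℕ} (v : Fin d → ℂ) {i j : Fin d} (hij : i ≠ j)
    (hi : ‖v i‖ ≤ 1) (hj : ‖v j‖ ≤ 1) :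
    ‖(Matrix.vandermonde v).det‖ ≤
      d.factorial * (d * ‖v i - v j‖ * (∏ l, max 1 ‖v l‖) ^ d) := by
  rw [← Matrix.det_updateRow_add_smul_self _ hij (-1), Matrix.det_apply]
  set A := (Matrix.vandermonde v).updateRow i
    (Matrix.vandermonde v i + (-1 : ℂ) • Matrix.vandermonde v j) with hA
  have hb : ∀ l k, ‖A l k‖ ≤ (if l = i then d * ‖v i - v j‖ else 1) * max 1 ‖v l‖ ^ d := by
    intro l k
    by_cases hl : l = i
    · subst hl
      simp only [hA, Matrix.updateRow_self, Pi.add_apply, Pi.smul_apply, Matrix.vandermonde_apply,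
        if_true, smul_eq_mul]
      rw [max_eq_left hi, one_pow, mul_one, neg_one_mul, ← sub_eq_add_neg]
      refine (norm_pow_sub_pow_le hi hj k).trans ?_
      gcongr
      exact k.2.le
    · simp only [hA, Matrix.updateRow_ne hl, Matrix.vandermonde_apply, hl, if_false, one_mul,
        norm_pow]
      calc _ ≤ max 1 ‖v l‖ ^ (k : ℕ) := by gcongr; exact le_max_right _ _
        _ ≤ _ := pow_le_pow_right₀ (le_max_left _ _) k.2.le
  have ht : ∀ σ : Equiv.Perm (Fin d), ‖Equiv.Perm.sign σ • ∏ l, A (σ l) l‖ ≤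
      d * ‖v i - v j‖ * (∏ l, max 1 ‖v l‖) ^ d := by
    intro σ
    have h1 : ‖Equiv.Perm.sign σ • ∏ l, A (σ l) l‖ = ∏ l, ‖A (σ l) l‖ := by
      rw [← norm_prod]
      rcases Int.units_eq_one_or (Equiv.Perm.sign σ) with h | h <;> simp [h]
    rw [h1]
    calc _ ≤ ∏ l, ((if σ l = i then d * ‖v i - v j‖ else 1) * max 1 ‖v (σ l)‖ ^ d) :=
          Finset.prod_le_prod (fun _ _ => norm_nonneg _) fun l _ => hb _ _
      _ = ∏ l, ((if l = i then d * ‖v i - v j‖ else 1) * max 1 ‖v l‖ ^ d) :=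
          Equiv.prod_comp σ fun l => (if l = i then d * ‖v i - v j‖ else 1) * max 1 ‖v l‖ ^ d
      _ = _ := by
          rw [Finset.prod_mul_distrib, Finset.prod_pow]
          simp
  refine (norm_sum_le _ _).trans ((Finset.sum_le_card_nsmul _ _ _ fun σ _ => ht σ).trans ?_)
  simp [Fintype.card_perm]

/-- The product of the values of an integer polynomial at the roots of a monic integer polynomial
is an integer, hence at least `1` in absolute value if it does not vanish. -/
lemma one_le_prod_norm_aeval_roots {f : ℤ[X]} (hf : f.Monic) (g : ℤ[X])
    (h : ∀ z ∈ (f.map (Int.castRingHom ℂ)).roots, aeval z g ≠ 0) :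
    1 ≤ ((f.map (Int.castRingHom ℂ)).roots.map fun z => ‖aeval z g‖).prod := by
  have h1 := resultant_eq_prod_eval (f.map (Int.castRingHom ℂ)) (g.map (Int.castRingHom ℂ))
    g.natDegree natDegree_map_le (IsAlgClosed.splits _)
  rw [resultant_map_map, (hf.map _).leadingCoeff, one_pow, one_mul] at h1
  have h2 : (g.map (Int.castRingHom ℂ)).eval = fun z => aeval z g := by
    ext z
    rw [eval_map, aeval_def]; rfl
  rw [h2] at h1
  have h3 : ((f.map (Int.castRingHom ℂ)).roots.map fun z => ‖aeval z g‖).prod =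
      ‖((f.map (Int.castRingHom ℂ)).roots.map fun z => aeval z g).prod‖ := by
    have := map_multiset_prod (normHom : ℂ →*₀ ℝ)
      ((f.map (Int.castRingHom ℂ)).roots.map fun z => aeval z g)
    rw [Multiset.map_map] at this
    exact this.symm
  rw [h3, ← h1]
  have h4 : resultant f g (f.map (Int.castRingHom ℂ)).natDegree g.natDegree ≠ 0 := by
    intro h0
    rw [h0, map_zero, eq_comm, Multiset.prod_eq_zero_iff, Multiset.mem_map] at h1
    obtain ⟨z, hz, hz'⟩ := h1
    exact h z hz hz'
  have h5 : 1 ≤ |resultant f g (f.map (Int.castRingHom ℂ)).natDegree g.natDegree| :=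
    Int.one_le_abs h4
  rw [eq_intCast, Complex.norm_intCast]
  exact_mod_cast h5

/-- The radical of a monic integer polynomial is defined over the integers. -/
lemma exists_monic_nodup_roots {Q : ℤ[X]} (hQ : Q.Monic) :
    ∃ f : ℤ[X], f.Monic ∧ f.map (Int.castRingHom ℂ) ∣ Q.map (Int.castRingHom ℂ) ∧
      (f.map (Int.castRingHom ℂ)).roots.Nodup ∧
      ∀ z : ℂ, aeval z Q = 0 → aeval z f = 0 := by
  classical
  set q : ℚ[X] := Q.map (algebraMap ℤ ℚ) with hq
  have hqm : q.Monic := hQ.map _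
  set g := UniqueFactorizationMonoid.radical q with hg
  have hgq : g ∣ q := UniqueFactorizationMonoid.radical_dvd_self
  have hg0 : g ≠ 0 := UniqueFactorizationMonoid.radical_ne_zero
  -- Gauss's lemma: a rational factor of a monic integer polynomial is, up to a scalar, integral.
  obtain ⟨f, hf⟩ := IsIntegrallyClosed.eq_map_mul_C_of_dvd ℚ hQ hgq
  have hlc : g.leadingCoeff ≠ 0 := leadingCoeff_ne_zero.2 hg0
  have hfg : Associated (f.map (algebraMap ℤ ℚ)) g :=
    ⟨(isUnit_C.2 (isUnit_iff_ne_zero.2 hlc)).unit, hf⟩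
  have hfm : f.Monic := by
    have := congr_arg leadingCoeff hf
    rw [leadingCoeff_mul, leadingCoeff_C] at this
    have h1 := mul_right_cancel₀ hlc (this.trans (one_mul _).symm)
    exact monic_of_injective (algebraMap ℤ ℚ).injective_int h1
  have hcomp : ∀ p : ℤ[X], p.map (Int.castRingHom ℂ) =
      (p.map (algebraMap ℤ ℚ)).map (algebraMap ℚ ℂ) := by
    intro p
    rw [Polynomial.map_map]
    congr 1
  refine ⟨f, hfm, ?_, ?_, ?_⟩
  · rw [hcomp, hcomp]
    exact Polynomial.map_dvd _ (hfg.dvd.trans hgq)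
  · rw [hcomp]
    refine nodup_roots (Separable.map ?_)
    rw [PerfectField.separable_iff_squarefree]
    exact hfg.symm.squarefree_iff.1 UniqueFactorizationMonoid.squarefree_radical
  · intro z hz
    obtain ⟨m, hm⟩ := UniqueFactorizationMonoid.exists_dvd_radical_self_pow hqm.ne_zero
    have h1 : ∀ p : ℤ[X], aeval z (p.map (algebraMap ℤ ℚ)) = aeval z p :=
      fun p => aeval_map_algebraMap ℚ z p
    have h2 : aeval z (g ^ m) = 0 := by
      obtain ⟨w, hw⟩ := hm
      rw [hg, hw, map_mul, h1, hz, zero_mul]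
    rw [map_pow] at h2
    rw [← h1]
    exact aeval_eq_zero_of_dvd_aeval_eq_zero hfg.symm.dvd (eq_zero_of_pow_eq_zero h2)

lemma neg_mem_signPolynomials {n : ℕ} {Q : ℤ[X]} (hQ : Q ∈ signPolynomials n) :
    -Q ∈ signPolynomials n := by
  refine ⟨by simpa using hQ.1, fun i => ?_⟩
  have := hQ.2 i
  rw [coeff_neg]
  omega

lemma norm_coeff_le_one {n : ℕ} {Q : ℤ[X]} (hQ : Q ∈ signPolynomials n) (i : ℕ) :
    ‖(Q.map (Int.castRingHom ℂ)).coeff i‖ ≤ 1 := by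
  rw [coeff_map]
  rcases hQ.2 i with h | h | h <;> simp [h]

lemma leadingCoeff_eq_one_or_neg_one {n : ℕ} {Q : ℤ[X]} (hQ : Q ∈ signPolynomials n)
    (h0 : Q ≠ 0) : Q.leadingCoeff = 1 ∨ Q.leadingCoeff = -1 := by
  have h1 := leadingCoeff_ne_zero.2 h0
  rcases hQ.2 Q.natDegree with h | h | h
  · exact Or.inr h
  · exact absurd h h1
  · exact Or.inl h

lemma aeval_eq_sum_complex {n : ℕ} {Q : ℤ[X]} (hQ : Q ∈ signPolynomials n) (z : ℂ) :
    aeval z Q = ∑ i ∈ Finset.range (n + 1), (Q.map (Int.castRingHom ℂ)).coeff i * z ^ i := by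
  rw [aeval_eq_sum_range' (Nat.lt_succ_of_le hQ.1)]
  simp

lemma norm_aeval_le {n : ℕ} {Q : ℤ[X]} (hQ : Q ∈ signPolynomials n) (z : ℂ) :
    ‖aeval z Q‖ ≤ (n + 1) * max 1 ‖z‖ ^ n := by
  rw [aeval_eq_sum_complex hQ]
  refine (norm_sum_le_of_le (f := fun i => (Q.map (Int.castRingHom ℂ)).coeff i * z ^ i)
    (n := fun _ => max 1 ‖z‖ ^ n) _ fun i hi => ?_).trans (by simp)
  rw [norm_mul, norm_pow]
  calc _ ≤ 1 * max 1 ‖z‖ ^ i := by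
        gcongr
        · exact norm_coeff_le_one hQ i
        · exact le_max_right _ _
    _ ≤ _ := by
        rw [one_mul]
        exact pow_le_pow_right₀ (le_max_left _ _) (by simpa [Nat.lt_succ_iff] using hi)

lemma norm_aeval_sub_aeval_le {n : ℕ} {Q : ℤ[X]} (hQ : Q ∈ signPolynomials n) {a b : ℂ}
    (ha : ‖a‖ ≤ 1) (hb : ‖b‖ ≤ 1) :
    ‖aeval a Q - aeval b Q‖ ≤ (n + 1) * n * ‖a - b‖ := by
  rw [aeval_eq_sum_complex hQ, aeval_eq_sum_complex hQ, ← Finset.sum_sub_distrib]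
  refine (norm_sum_le_of_le
    (f := fun i => (Q.map (Int.castRingHom ℂ)).coeff i * a ^ i -
      (Q.map (Int.castRingHom ℂ)).coeff i * b ^ i)
    (n := fun _ => n * ‖a - b‖) _ fun i hi => ?_).trans (by simp [mul_assoc])
  rw [← mul_sub, norm_mul]
  calc _ ≤ 1 * (i * ‖a - b‖) := by
        gcongr
        · exact norm_coeff_le_one hQ i
        · exact norm_pow_sub_pow_le ha hb i
    _ ≤ _ := by
        rw [one_mul]
        gcongr
        simpa [Nat.lt_succ_iff] using hi

lemma mahlerMeasure_le_of_mem_signPolynomials {n : ℕ} {Q : ℤ[X]} (hQ : Q ∈ signPolynomials n) :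
    (Q.map (Int.castRingHom ℂ)).mahlerMeasure ≤ n + 1 := by
  refine (mahlerMeasure_le_sum_norm_coeff _).trans ?_
  rw [sum_over_range' _ (by simp) (n + 1) (Nat.lt_succ_of_le (natDegree_map_le.trans hQ.1))]
  refine (Finset.sum_le_card_nsmul _ _ 1 fun i _ => norm_coeff_le_one hQ i).trans ?_
  simp

/-- The product is the Mahler measure of `f`. Mahler measure is multiplicative, and the cofactor has
leading coefficient of modulus 1, so its measure is at least 1. -/
lemma prod_max_one_norm_roots_le {n : ℕ} {Q f : ℤ[X]} (hQ : Q ∈ signPolynomials n) (h0 : Q ≠ 0)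
    (hf : f.Monic) (hfQ : f.map (Int.castRingHom ℂ) ∣ Q.map (Int.castRingHom ℂ)) :
    ((f.map (Int.castRingHom ℂ)).roots.map fun z => max 1 ‖z‖).prod ≤ n + 1 := by
  obtain ⟨h, hh⟩ := hfQ
  have h1 : (f.map (Int.castRingHom ℂ)).mahlerMeasure =
      ((f.map (Int.castRingHom ℂ)).roots.map fun z => max 1 ‖z‖).prod := by
    rw [mahlerMeasure_eq_leadingCoeff_mul_prod_roots, (hf.map _).leadingCoeff]
    simp
  have h2 : ‖h.leadingCoeff‖ = 1 := by
    have h3 := congr_arg (fun p => ‖leadingCoeff p‖) hh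
    simp only [leadingCoeff_mul, (hf.map _).leadingCoeff, one_mul] at h3
    rw [← h3, leadingCoeff_map_of_injective (Int.castRingHom ℂ).injective_int]
    rcases leadingCoeff_eq_one_or_neg_one hQ h0 with h | h <;> simp [h]
  have h3 := mahlerMeasure_le_of_mem_signPolynomials hQ
  rw [hh, mahlerMeasure_mul, h1] at h3
  refine le_trans (le_mul_of_one_le_right ?_ (one_le_mahlerMeasure_of_one_le_norm_leadingCoeff
    h2.ge)) h3
  rw [← h1]
  exact mahlerMeasure_nonneg _

/-- Liouville's inequality. -/
lemma one_le_norm_aeval_mul_of_isRoot {n : ℕ} {P Q : ℤ[X]} (hP : P ∈ signPolynomials n)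
    (hP0 : P ≠ 0) (hQ : Q ∈ signPolynomials n) {a : ℂ} (ha : aeval a P = 0)
    (hQa : aeval a Q ≠ 0) (ha1 : ‖a‖ ≤ 1) :
    1 ≤ ‖aeval a Q‖ * (n + 1) ^ (2 * n) := by
  wlog hm : P.Monic generalizing P
  · refine this (neg_mem_signPolynomials hP) (neg_ne_zero.2 hP0) (by simpa using ha) ?_
    rcases leadingCoeff_eq_one_or_neg_one hP hP0 with h | h
    · exact absurd h hm
    · rw [Monic, leadingCoeff_neg, h, neg_neg]
  have hint : IsIntegral ℤ a := ⟨P, hm, ha⟩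
  set f := minpoly ℤ a with hf
  have hfm : f.Monic := minpoly.monic hint
  have hfP : f.map (Int.castRingHom ℂ) ∣ P.map (Int.castRingHom ℂ) :=
    Polynomial.map_dvd _ (minpoly.isIntegrallyClosed_dvd hint ha)
  -- The conjugates of `a` share its minimal polynomial, so `Q` vanishes at none of them.
  have h1 := one_le_prod_norm_aeval_roots hfm Q (by
    intro z hz hQz
    have hfz : aeval z f = 0 := by
      rw [mem_roots (hfm.map _).ne_zero, IsRoot, eval_map] at hz
      exact hz
    have hzint : IsIntegral ℤ z := ⟨f, hfm, hfz⟩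
    have hzf : Associated (minpoly ℤ z) f :=
      (minpoly.irreducible hzint).associated_of_dvd (minpoly.irreducible hint)
        (minpoly.isIntegrallyClosed_dvd hzint hfz)
    exact hQa (aeval_eq_zero_of_dvd_aeval_eq_zero
      (hzf.symm.dvd.trans (minpoly.isIntegrallyClosed_dvd hzint hQz)) (minpoly.aeval ℤ a)))
  have h2 := prod_max_one_norm_roots_le hP hP0 hfm hfP
  have hcard : Multiset.card (f.map (Int.castRingHom ℂ)).roots ≤ n :=
    (card_roots' _).trans ((natDegree_le_of_dvd hfP (hm.map _).ne_zero).trans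
      (natDegree_map_le.trans hP.1))
  have hmem : a ∈ (f.map (Int.castRingHom ℂ)).roots := by
    rw [mem_roots (hfm.map _).ne_zero, IsRoot, eval_map]
    exact minpoly.aeval ℤ a
  obtain ⟨s, hs⟩ := Multiset.exists_cons_of_mem hmem
  rw [hs, Multiset.map_cons, Multiset.prod_cons] at h1 h2
  rw [hs, Multiset.card_cons] at hcard
  rw [max_eq_left ha1, one_mul] at h2
  have h3 : (s.map fun z => ‖aeval z Q‖).prod ≤
      (s.map fun z => ((n : ℝ) + 1) * max 1 ‖z‖ ^ n).prod :=
    Multiset.prod_map_le_prod_map₀ _ _ (fun _ _ => norm_nonneg _)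
      fun z _ => norm_aeval_le hQ z
  rw [Multiset.prod_map_mul, Multiset.map_const', Multiset.prod_replicate,
    Multiset.prod_map_pow] at h3
  have hn1 : (1 : ℝ) ≤ n + 1 := by linarith [n.cast_nonneg (α := ℝ)]
  have h4 : 0 ≤ (s.map fun z => max 1 ‖z‖).prod :=
    Multiset.prod_nonneg (by
      intro x hx
      obtain ⟨z, -, rfl⟩ := Multiset.mem_map.1 hx
      exact zero_le_one.trans (le_max_left _ _))
  calc (1 : ℝ) ≤ _ := h1
    _ ≤ ‖aeval a Q‖ * (((n : ℝ) + 1) ^ n * (n + 1) ^ n) := by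
        gcongr
        refine h3.trans ?_
        gcongr
        omega
    _ = _ := by rw [two_mul, pow_add]

lemma prod_prod_compl_sub {d : ℕ} (v : Fin d → ℂ) :
    ∏ i, ∏ j ∈ {i}ᶜ, ‖v i - v j‖ = ‖(Matrix.vandermonde v).det‖ ^ 2 := by
  rw [← Finset.prod_prod_Ioi_mul_eq_prod_prod_off_diag fun j i => ‖v i - v j‖,
    Matrix.det_vandermonde, norm_prod, ← Finset.prod_pow]
  refine Finset.prod_congr rfl fun i _ => ?_
  rw [norm_prod, ← Finset.prod_pow]
  refine Finset.prod_congr rfl fun j _ => ?_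
  rw [norm_sub_rev (v i), sq]

lemma exists_enumeration_roots {F : ℂ[X]} (hF : F.Monic) (hn : F.roots.Nodup) :
    ∃ v : Fin F.natDegree → ℂ, Function.Injective v ∧ F = ∏ i, (X - C (v i)) := by
  have hl : F.roots.toList.length = F.natDegree := by
    rw [Multiset.length_toList, (IsAlgClosed.splits F).natDegree_eq_card_roots]
  refine hl ▸ ⟨fun i => F.roots.toList.get i, ?_, ?_⟩
  · exact List.nodup_iff_injective_get.1 (Multiset.coe_nodup.1 (by simpa using hn))
  · conv_lhs => rw [(IsAlgClosed.splits F).eq_prod_roots_of_monic hF, ← Multiset.prod_map_toList]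
    exact (Fin.prod_univ_fun_getElem _ _).symm

/-- Distinct roots of a sign polynomial are well separated. -/
lemma one_le_norm_sub_mul_of_isRoot {n : ℕ} {Q : ℤ[X]} (hQ : Q ∈ signPolynomials n) (h0 : Q ≠ 0)
    {a b : ℂ} (hab : a ≠ b) (ha : aeval a Q = 0) (hb : aeval b Q = 0) (ha1 : ‖a‖ ≤ 1)
    (hb1 : ‖b‖ ≤ 1) :
    1 ≤ ‖a - b‖ * (n.factorial * n * (n + 1) ^ n) := by
  wlog hm : Q.Monic generalizing Q
  · refine this (neg_mem_signPolynomials hQ) (neg_ne_zero.2 h0) (by simpa using ha)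
      (by simpa using hb) ?_
    rcases leadingCoeff_eq_one_or_neg_one hQ h0 with h | h
    · exact absurd h hm
    · rw [Monic, leadingCoeff_neg, h, neg_neg]
  -- `Q` may have multiple roots; its radical has nonzero discriminant.
  obtain ⟨f, hfm, hfQ, hnd, hroots⟩ := exists_monic_nodup_roots hm
  set F := f.map (Int.castRingHom ℂ) with hF
  have hFm : F.Monic := hfm.map _
  obtain ⟨v, hvi, hv⟩ := exists_enumeration_roots hFm hnd
  have hFr : F.roots = Finset.univ.val.map v := by
    conv_lhs => rw [hv]
    exact (congr_arg roots (Multiset.map_map (fun a => X - C a) v _ ▸ rfl)).trans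
      (roots_multiset_prod_X_sub_C (Finset.univ.val.map v))
  have hmem : ∀ z : ℂ, aeval z Q = 0 → ∃ i, v i = z := by
    intro z hz
    have h1 : z ∈ F.roots := by
      rw [mem_roots hFm.ne_zero, IsRoot, eval_map]
      exact hroots z hz
    rw [hFr] at h1
    simpa using h1
  obtain ⟨i, rfl⟩ := hmem a ha
  obtain ⟨j, rfl⟩ := hmem b hb
  have hij : i ≠ j := fun h => hab (by rw [h])
  have hder : ∀ l, aeval (v l) (derivative f) = ∏ k ∈ {l}ᶜ, (v l - v k) := by
    intro l
    have h1 : aeval (v l) (derivative f) = eval (v l) (derivative F) := by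
      rw [hF, derivative_map, eval_map]; rfl
    rw [h1, congr_arg derivative hv, derivative_prod_finset, eval_finsetSum,
      Finset.sum_eq_single l]
    · simp [eval_prod, Finset.compl_eq_univ_sdiff, Finset.sdiff_singleton_eq_erase]
    · intro k _ hk
      rw [eval_mul, eval_prod, Finset.prod_eq_zero (i := l)]
      · simp
      · simp [hk.symm]
      · simp
    · simp
  -- The product of `f'` over the roots of `f` is, up to sign, the discriminant, which is the square
  -- of the Vandermonde determinant.
  have h1 := one_le_prod_norm_aeval_roots hfm (derivative f) (by
    intro z hz
    rw [← hF, hFr] at hz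
    obtain ⟨l, -, rfl⟩ := Multiset.mem_map.1 hz
    rw [hder, Finset.prod_ne_zero_iff]
    intro k hk
    simp only [Finset.mem_compl, Finset.mem_singleton] at hk
    exact sub_ne_zero.2 fun h => hk (hvi h).symm)
  rw [← hF, hFr, Multiset.map_map] at h1
  change 1 ≤ ∏ l, ‖aeval (v l) (derivative f)‖ at h1
  simp_rw [hder, norm_prod] at h1
  rw [prod_prod_compl_sub] at h1
  have h2 : 1 ≤ ‖(Matrix.vandermonde v).det‖ := (one_le_sq_iff₀ (norm_nonneg _)).1 h1
  have hd : F.natDegree ≤ n := by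
    refine (natDegree_le_of_dvd hfQ ?_).trans (natDegree_map_le.trans hQ.1)
    exact (hm.map _).ne_zero
  have h3 : ∏ l, max 1 ‖v l‖ ≤ (n : ℝ) + 1 := by
    have := prod_max_one_norm_roots_le hQ h0 hfm hfQ
    rw [← hF, hFr, Multiset.map_map] at this
    exact this
  have h4 : ∀ l, 0 ≤ max 1 ‖v l‖ := fun l => zero_le_one.trans (le_max_left _ _)
  calc (1 : ℝ) ≤ _ := h2
    _ ≤ _ := norm_det_vandermonde_le v hij ha1 hb1
    _ ≤ n.factorial * (n * ‖v i - v j‖ * (n + 1) ^ n) := by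
        gcongr ?_ * (?_ * _ * ?_)
        · exact_mod_cast Nat.factorial_le hd
        · exact_mod_cast hd
        · calc _ ≤ ((n : ℝ) + 1) ^ F.natDegree :=
                pow_le_pow_left₀ (Finset.prod_nonneg fun l _ => h4 l) h3 _
            _ ≤ _ := pow_le_pow_right₀ (by linarith [n.cast_nonneg (α := ℝ)]) hd
    _ = _ := by ring

/-! ### Location and number of roots -/

lemma exists_eq_X_pow_mul {n : ℕ} {Q : ℤ[X]} (hQ : Q ∈ signPolynomials n) (h0 : Q ≠ 0) :
    ∃ (j : ℕ) (R : ℤ[X]), Q = X ^ j * R ∧ R ∈ signPolynomials n ∧ R.coeff 0 ≠ 0 ∧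
      j + R.natDegree ≤ n := by
  obtain ⟨R, hR⟩ := X_pow_dvd_iff.2 fun d hd => coeff_eq_zero_of_lt_natTrailingDegree
    (p := Q) (n := d) hd
  have hR0 : R ≠ 0 := by
    rintro rfl
    exact h0 (by simpa using hR)
  have hc : ∀ i, R.coeff i = Q.coeff (i + Q.natTrailingDegree) := by
    intro i
    rw [congr_arg (fun p => p.coeff (i + Q.natTrailingDegree)) hR]
    exact (coeff_X_pow_mul _ _ _).symm
  have hdeg : Q.natTrailingDegree + R.natDegree ≤ n := by
    have h1 := hQ.1
    rw [hR, natDegree_X_pow_mul _ hR0] at h1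
    omega
  refine ⟨_, R, hR, ⟨by omega, fun i => hc i ▸ hQ.2 _⟩, ?_, hdeg⟩
  rw [hc, zero_add]
  exact trailingCoeff_nonzero_iff_nonzero.2 h0

/-- Nonzero roots of sign polynomials have absolute value at least `1 / 2`. -/
lemma one_half_le_norm_of_isRoot {n : ℕ} {P : ℤ[X]} (hP : P ∈ signPolynomials n) (h0 : P ≠ 0)
    {z : ℂ} (hz0 : z ≠ 0) (hz : aeval z P = 0) : 1 / 2 ≤ ‖z‖ := by
  obtain ⟨j, R, rfl, hR, hR0, -⟩ := exists_eq_X_pow_mul hP h0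
  rw [map_mul, map_pow, aeval_X, mul_eq_zero, or_iff_right (pow_ne_zero _ hz0),
    aeval_eq_sum_complex hR, Finset.sum_range_succ', pow_zero, mul_one] at hz
  by_contra! hlt
  have h1 : ‖(R.map (Int.castRingHom ℂ)).coeff 0‖ = 1 := by
    rw [coeff_map]
    rcases hR.2 0 with h | h | h
    · simp [h]
    · exact absurd h hR0
    · simp [h]
  have h2 : ‖∑ i ∈ Finset.range n, (R.map (Int.castRingHom ℂ)).coeff (i + 1) * z ^ (i + 1)‖ ≤
      ∑ i ∈ Finset.range n, (1 / 2 : ℝ) * (1 / 2) ^ i := by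
    refine norm_sum_le_of_le _ fun i _ => ?_
    rw [norm_mul, norm_pow, ← pow_succ']
    calc _ ≤ 1 * (1 / 2 : ℝ) ^ (i + 1) := by
          gcongr
          exact norm_coeff_le_one hR _
      _ = _ := one_mul _
  rw [eq_neg_of_add_eq_zero_left hz, norm_neg, h1, ← Finset.mul_sum, geom_sum_eq (by norm_num)] at h2
  have h3 : (0 : ℝ) < (1 / 2) ^ n := by positivity
  have h4 : (1 / 2 : ℝ) * (((1 / 2) ^ n - 1) / (1 / 2 - 1)) = 1 - (1 / 2) ^ n := by ring
  linarith

lemma map_int_eq_prod_roots (Q : ℤ[X]) :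
    Q.map (Int.castRingHom ℂ) = C (Q.leadingCoeff : ℂ) *
      ((Q.map (Int.castRingHom ℂ)).roots.map fun z => X - C z).prod := by
  conv_lhs => rw [(IsAlgClosed.splits (Q.map (Int.castRingHom ℂ))).eq_prod_roots,
    leadingCoeff_map_of_injective (Int.castRingHom ℂ).injective_int]
  rfl

lemma norm_multiset_prod (s : Multiset ℂ) (g : ℂ → ℂ) :
    ‖(s.map g).prod‖ = (s.map fun z => ‖g z‖).prod := by
  have := map_multiset_prod (normHom : ℂ →*₀ ℝ) (s.map g)
  rw [Multiset.map_map] at this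
  exact this

lemma norm_aeval_eq_prod_roots {n : ℕ} {Q : ℤ[X]} (hQ : Q ∈ signPolynomials n) (h0 : Q ≠ 0)
    (x : ℂ) :
    ‖aeval x Q‖ = ((Q.map (Int.castRingHom ℂ)).roots.map fun z => ‖x - z‖).prod := by
  have h1 : aeval x Q = (Q.map (Int.castRingHom ℂ)).eval x := by
    rw [eval_map]; rfl
  have h2 : ‖(Q.leadingCoeff : ℂ)‖ = 1 := by
    rcases leadingCoeff_eq_one_or_neg_one hQ h0 with h | h <;> simp [h]
  rw [h1, map_int_eq_prod_roots, eval_mul, eval_C, norm_mul, h2, one_mul, eval_multiset_prod,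
    Multiset.map_map, norm_multiset_prod, ← map_int_eq_prod_roots]
  simp

/-- Jensen's formula on the circle of radius `ρ`: the factor `ρ X - z` has Mahler measure `max ρ
‖z‖`. -/
lemma mahlerMeasure_comp_C_mul_X {n : ℕ} {Q : ℤ[X]} (hQ : Q ∈ signPolynomials n) (h0 : Q ≠ 0)
    {ρ : ℝ} (hρ : 0 < ρ) :
    ((Q.map (Int.castRingHom ℂ)).comp (C (ρ : ℂ) * X)).mahlerMeasure =
      ((Q.map (Int.castRingHom ℂ)).roots.map fun z => max ρ ‖z‖).prod := by
  have h2 : ‖(Q.leadingCoeff : ℂ)‖ = 1 := by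
    rcases leadingCoeff_eq_one_or_neg_one hQ h0 with h | h <;> simp [h]
  rw [map_int_eq_prod_roots, mul_comp, C_comp, mahlerMeasure_mul, mahlerMeasure_const, h2, one_mul,
    multiset_prod_comp, Multiset.map_map, prod_mahlerMeasure_eq_mahlerMeasure_prod,
    Multiset.map_map, ← map_int_eq_prod_roots]
  congr 1
  refine Multiset.map_congr rfl fun z _ => ?_
  have h3 : (C (ρ : ℂ) * X - C z : ℂ[X]) = C (ρ : ℂ) * X + C (-z) := by simp [sub_eq_add_neg]
  simp only [Function.comp_apply, sub_comp, X_comp, C_comp]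
  rw [h3, mahlerMeasure_C_mul_X_add_C (by exact_mod_cast hρ.ne')]
  simp [abs_of_pos hρ]

lemma multiset_prod_ite {α : Type*} (s : Multiset α) (p : α → Prop) [DecidablePred p] (c : ℝ) :
    (s.map fun z => if p z then c else 1).prod = c ^ Multiset.card (s.filter p) := by
  induction s using Multiset.induction_on with
  | empty => simp
  | cons a s ih => by_cases h : p a <;> simp [h, ih, pow_succ']

/-- A sign polynomial with nonzero constant term has a bounded number of roots in a disc strictly
inside the unit disc, independently of its degree. -/
lemma exists_card_roots_filter_le {σ : ℝ} (h0 : 0 < σ) (h1 : σ < 1) :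
    ∃ K : ℕ, ∀ n : ℕ, ∀ Q ∈ signPolynomials n, Q.coeff 0 ≠ 0 →
      Multiset.card ((Q.map (Int.castRingHom ℂ)).roots.filter fun z => ‖z‖ ≤ σ) ≤ K := by
  obtain ⟨ρ, hσρ, hρ1⟩ := exists_between h1
  have hρ0 : 0 < ρ := h0.trans hσρ
  have hq : 1 < ρ / σ := (one_lt_div h0).2 hσρ
  obtain ⟨K, hK⟩ := pow_unbounded_of_one_lt (1 - ρ)⁻¹ hq
  refine ⟨K, fun n Q hQ hc => ?_⟩
  have hQ0 : Q ≠ 0 := by rintro rfl; simp at hc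
  have h2 : ((Q.map (Int.castRingHom ℂ)).roots.map fun z => ‖z‖).prod = 1 := by
    have h3 := norm_aeval_eq_prod_roots hQ hQ0 0
    simp only [zero_sub, norm_neg] at h3
    rw [← h3, ← coeff_zero_eq_aeval_zero']
    rcases hQ.2 0 with h | h | h
    · simp [h]
    · exact absurd h hc
    · simp [h]
  -- Since the moduli of the roots multiply to 1, each root inside radius `σ` gains a factor `ρ / σ`
  -- when its modulus is replaced by at least `ρ`.
  have h4 : (ρ / σ) ^ Multiset.card ((Q.map (Int.castRingHom ℂ)).roots.filter fun z => ‖z‖ ≤ σ) ≤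
      ((Q.map (Int.castRingHom ℂ)).roots.map fun z => max ρ ‖z‖).prod := by
    rw [← multiset_prod_ite]
    refine (mul_one _).symm.le.trans ((congr_arg (_ * ·) h2.symm).le.trans ?_)
    rw [← Multiset.prod_map_mul]
    refine Multiset.prod_map_le_prod_map₀ _ _ (fun z _ => ?_) fun z _ => ?_
    · split_ifs <;> positivity
    · split_ifs with h
      · refine le_trans ?_ (le_max_left _ _)
        rw [div_mul_eq_mul_div, div_le_iff₀ h0]
        gcongr
      · rw [one_mul]; exact le_max_right _ _
  have h5 : ((Q.map (Int.castRingHom ℂ)).roots.map fun z => max ρ ‖z‖).prod ≤ (1 - ρ)⁻¹ := by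
    rw [← mahlerMeasure_comp_C_mul_X hQ hQ0 hρ0]
    refine (mahlerMeasure_le_sum_norm_coeff _).trans ?_
    have hd : ((Q.map (Int.castRingHom ℂ)).comp (C (ρ : ℂ) * X)).natDegree < n + 1 := by
      refine Nat.lt_succ_of_le (natDegree_comp_le.trans ?_)
      calc _ ≤ n * 1 := Nat.mul_le_mul (natDegree_map_le.trans hQ.1)
            (natDegree_C_mul_le _ _ |>.trans natDegree_X_le)
        _ = n := mul_one n
    rw [sum_over_range' _ (by simp) _ hd]
    calc _ ≤ ∑ i ∈ Finset.range (n + 1), ρ ^ i := by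
          refine Finset.sum_le_sum fun i _ => ?_
          rw [comp_C_mul_X_coeff, norm_mul, norm_pow, Complex.norm_real, Real.norm_of_nonneg hρ0.le]
          exact mul_le_of_le_one_left (by positivity) (norm_coeff_le_one hQ i)
      _ ≤ ∑' i, ρ ^ i := (summable_geometric_of_lt_one hρ0.le hρ1).sum_le_tsum _
          fun i _ => by positivity
      _ = _ := tsum_geometric_of_lt_one hρ0.le hρ1
  by_contra! hlt
  exact absurd (hK.trans_le ((pow_le_pow_right₀ hq.le hlt.le).trans (h4.trans h5))) (lt_irrefl _)

/-! ### Lower bound for sign polynomials near `η` -/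

lemma two_mul_succ_pow_le {n : ℕ} (hn : 3 ≤ n) : (2 * (n + 1)) ^ n ≤ n ^ (2 * n) := by
  rw [pow_mul]
  exact Nat.pow_le_pow_left (by nlinarith) n

lemma succ_pow_le {n : ℕ} (hn : 3 ≤ n) : (n + 1) ^ (2 * n + 2) ≤ n ^ (4 * n) := by
  have h1 : (n + 1) ^ (n + 1) ≤ n ^ (2 * n) :=
    calc (n + 1) ^ (n + 1) = (n + 1) * (n + 1) ^ n := pow_succ' _ _
      _ ≤ 2 ^ n * (n + 1) ^ n := Nat.mul_le_mul_right _ n.lt_two_pow_self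
      _ = (2 * (n + 1)) ^ n := (mul_pow _ _ _).symm
      _ ≤ _ := two_mul_succ_pow_le hn
  calc (n + 1) ^ (2 * n + 2) = ((n + 1) ^ (n + 1)) ^ 2 := by rw [← pow_mul]; ring
    _ ≤ (n ^ (2 * n)) ^ 2 := Nat.pow_le_pow_left h1 2
    _ = _ := by rw [← pow_mul]; ring

lemma two_mul_factorial_mul_le {n : ℕ} (hn : 3 ≤ n) :
    2 * (n.factorial * n * (n + 1) ^ n) ≤ n ^ (4 * n) := by
  have h2 : 2 * n ≤ 2 ^ n := by
    obtain ⟨m, rfl⟩ : ∃ m, n = m + 1 := ⟨n - 1, by omega⟩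
    rw [pow_succ']
    exact Nat.mul_le_mul_left _ m.lt_two_pow_self
  calc 2 * (n.factorial * n * (n + 1) ^ n) = n.factorial * (2 * n * (n + 1) ^ n) := by ring
    _ ≤ n ^ n * (2 ^ n * (n + 1) ^ n) := by
        gcongr
        exact n.factorial_le_pow
    _ = n ^ n * (2 * (n + 1)) ^ n := by rw [mul_pow]
    _ ≤ n ^ n * n ^ (2 * n) := Nat.mul_le_mul_left _ (two_mul_succ_pow_le hn)
    _ = n ^ (3 * n) := by rw [← pow_add]; ring
    _ ≤ _ := Nat.pow_le_pow_right (by omega) (by omega)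

/-- If `lam` is very close to a root of a sign polynomial, sign polynomials are not too small
at `lam`. -/
lemma exists_norm_pow_le_norm_aeval {ε : ℝ} (hε : 0 < ε) (hε1 : ε < 1) :
    ∃ K N : ℕ, ∀ n : ℕ, N ≤ n → ∀ lam : ℝ, 0 < lam → lam ≤ 1 - ε → ∀ η : ℂ, η ≠ 0 →
      (∃ P ∈ signPolynomials n, P ≠ 0 ∧ aeval η P = 0) →
      ‖(lam : ℂ) - η‖ * (n : ℝ) ^ (4 * n) < 1 → ∀ Q ∈ signPolynomials n, Q ≠ 0 →
      ‖(lam : ℂ) - η‖ ^ (K + 1) ≤ ‖aeval (lam : ℂ) Q‖ := by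
  obtain ⟨K, hK⟩ := exists_card_roots_filter_le (σ := 1 - ε / 2) (by linarith) (by linarith)
  -- `ε / 2` bounds the distance from `lam` to roots outside the disc of radius `1 - ε / 2`; `1 / 4`
  -- makes `κ ≤ lam`, as `‖η‖ ≥ 1 / 2`.
  set κ : ℝ := min (ε / 2) (1 / 4) with hκ
  have hκ0 : 0 < κ := lt_min (by linarith) (by norm_num)
  have hκε : κ ≤ ε / 2 := min_le_left _ _
  have hκ4 : κ ≤ 1 / 4 := min_le_right _ _
  obtain ⟨N, hN⟩ := exists_nat_ge κ⁻¹
  refine ⟨K, max N 3, fun n hn lam hlam0 hlam η hη hP hδ Q hQ hQ0 => ?_⟩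
  obtain ⟨P, hP, hP0, hPη⟩ := hP
  have hn3 : 3 ≤ n := (le_max_right _ _).trans hn
  have hnκ : κ⁻¹ ≤ n := hN.trans (by exact_mod_cast (le_max_left _ _).trans hn)
  have hn0 : (0 : ℝ) < n := by positivity
  have hn1 : (1 : ℝ) ≤ n := by exact_mod_cast (by omega : 1 ≤ n)
  set δ := ‖(lam : ℂ) - η‖ with hδdef
  have hδ0 : 0 ≤ δ := norm_nonneg _
  have hnlam : ‖(lam : ℂ)‖ = lam := by rw [Complex.norm_real, Real.norm_of_nonneg hlam0.le]
  have hκn : (n : ℝ)⁻¹ ≤ κ := inv_le_of_inv_le₀ hκ0 hnκ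
  have hδκn : δ ≤ κ ^ n := by
    calc δ ≤ ((n : ℝ) ^ (4 * n))⁻¹ := by
          rw [← one_div, le_div_iff₀ (by positivity)]; exact hδ.le
      _ ≤ ((n : ℝ) ^ n)⁻¹ := by gcongr ?_⁻¹; exact pow_le_pow_right₀ hn1 (by omega)
      _ = ((n : ℝ)⁻¹) ^ n := by rw [inv_pow]
      _ ≤ _ := by gcongr
  have hδκ : δ ≤ κ := hδκn.trans (pow_le_of_le_one hκ0.le (by linarith) (by omega))
  have hη1 : ‖η‖ ≤ 1 := by
    have := norm_sub_norm_le η lam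
    rw [norm_sub_rev, hnlam] at this
    linarith
  have hlam4 : 1 / 4 ≤ lam := by
    have h1 := one_half_le_norm_of_isRoot hP hP0 hη hPη
    have := norm_sub_norm_le η lam
    rw [norm_sub_rev, hnlam] at this
    linarith
  have hδ1 : δ ≤ 1 := by linarith
  by_cases hQη : aeval η Q = 0
  · obtain ⟨j, R, rfl, hR, hRc, hj⟩ := exists_eq_X_pow_mul hQ hQ0
    have hR0 : R ≠ 0 := by rintro rfl; simp at hRc
    rw [map_mul, map_pow, aeval_X, mul_eq_zero, or_iff_right (pow_ne_zero _ hη)] at hQη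
    -- The extra `κ` on the inner roots is wasted, but makes the product uniformly `δ ^ K * κ ^
    -- R.natDegree`.
    have hfac : ∀ z ∈ (R.map (Int.castRingHom ℂ)).roots,
        (if ‖z‖ ≤ 1 - ε / 2 then δ else 1) * κ ≤ ‖(lam : ℂ) - z‖ := by
      intro z hz
      rw [mem_roots ((Polynomial.map_ne_zero_iff (Int.castRingHom ℂ).injective_int).2 hR0),
        IsRoot, eval_map] at hz
      split_ifs with h
      · refine (mul_le_of_le_one_right hδ0 (by linarith)).trans ?_
        rcases eq_or_ne η z with rfl | hne
        · exact le_rfl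
        have h1 := one_le_norm_sub_mul_of_isRoot hR hR0 hne hQη hz hη1 (by linarith)
        have h2 : (2 : ℝ) * (n.factorial * n * (n + 1) ^ n) ≤ n ^ (4 * n) := by
          exact_mod_cast two_mul_factorial_mul_le hn3
        have h3 : 2 * δ ≤ ‖η - z‖ := by
          by_contra! hlt
          have h4 : (0 : ℝ) < n.factorial * n * (n + 1) ^ n := by positivity
          nlinarith
        have h5 : ‖η - z‖ ≤ δ + ‖(lam : ℂ) - z‖ := by
          rw [hδdef, norm_sub_rev (lam : ℂ) η]
          exact norm_sub_le_norm_sub_add_norm_sub _ _ _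
        linarith
      · have := norm_sub_norm_le z lam
        rw [norm_sub_rev, hnlam] at this
        linarith
    have hcard : Multiset.card (R.map (Int.castRingHom ℂ)).roots ≤ R.natDegree :=
      (card_roots' _).trans natDegree_map_le
    have hprod : δ ^ K * κ ^ R.natDegree ≤ ‖aeval (lam : ℂ) R‖ := by
      rw [norm_aeval_eq_prod_roots hR hR0]
      refine le_trans ?_ (Multiset.prod_map_le_prod_map₀ _ _ (fun z _ => ?_) hfac)
      · rw [Multiset.prod_map_mul, multiset_prod_ite, Multiset.map_const', Multiset.prod_replicate]
        exact mul_le_mul (pow_le_pow_of_le_one hδ0 hδ1 (hK n R hR hRc))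
          (pow_le_pow_of_le_one hκ0.le (by linarith) hcard) (by positivity) (by positivity)
      · split_ifs <;> positivity
    rw [map_mul, norm_mul, map_pow, aeval_X, norm_pow, hnlam]
    calc δ ^ (K + 1) = δ ^ K * δ := pow_succ _ _
      _ ≤ δ ^ K * κ ^ (j + R.natDegree) := by
          gcongr
          exact hδκn.trans (pow_le_pow_of_le_one hκ0.le (by linarith) hj)
      _ = κ ^ j * (δ ^ K * κ ^ R.natDegree) := by rw [pow_add]; ring
      _ ≤ lam ^ j * ‖aeval (lam : ℂ) R‖ := by gcongr; linarith
  · have h1 := one_le_norm_aeval_mul_of_isRoot hP hP0 hQ hPη hQη hη1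
    have h2 := norm_aeval_sub_aeval_le hQ hη1 (b := (lam : ℂ)) (by rw [hnlam]; linarith)
    rw [norm_sub_rev η] at h2
    have h3 := norm_sub_norm_le (aeval η Q) (aeval (lam : ℂ) Q)
    have h4 : ((n : ℝ) + 1) ^ (2 * n + 2) ≤ n ^ (4 * n) := by exact_mod_cast succ_pow_le hn3
    have h5 : (0 : ℝ) < ((n : ℝ) + 1) ^ (2 * n) := by positivity
    -- Passing from `η` to `lam` loses at most `n (n + 1) δ` of this, leaving `(n + 1) δ ≥ δ`.
    have h6 : δ * ((n : ℝ) + 1) ^ 2 ≤ ‖aeval η Q‖ := by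
      refine le_of_mul_le_mul_right ?_ h5
      calc _ = δ * ((n : ℝ) + 1) ^ (2 * n + 2) := by rw [pow_add]; ring
        _ ≤ δ * n ^ (4 * n) := by gcongr
        _ ≤ 1 := hδ.le
        _ ≤ _ := h1
    have h7 : δ ≤ ‖aeval (lam : ℂ) Q‖ := by
      have : 0 ≤ δ * n := by positivity
      nlinarith
    exact (pow_le_of_le_one hδ0 hδ1 (by omega)).trans h7

/-! ### From separation to the theorem -/

lemma exists_signPolynomial_of_ne {n : ℕ} (x : ℝ) {s s' : Fin n → Bool} (h : s ≠ s') :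
    ∃ Q ∈ signPolynomials n, Q ≠ 0 ∧
      |signSum n x s - signSum n x s'| = 2 * ‖aeval (x : ℂ) Q‖ := by
  classical
  set c : Fin n → ℤ := fun j => (if s j then 1 else 0) - (if s' j then 1 else 0) with hc
  set Q : ℤ[X] := ∑ j : Fin n, C (c j) * X ^ (j : ℕ) with hQ
  have hcoeff : ∀ j : Fin n, Q.coeff j = c j := by
    intro j
    simp [hQ, coeff_X_pow, ← Fin.ext_iff]
  have hdeg : Q.degree < n := degree_sum_fin_lt c
  refine ⟨Q, ⟨natDegree_le_of_degree_le hdeg.le, fun i => ?_⟩, ?_, ?_⟩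
  · by_cases hi : i < n
    · rw [show i = ((⟨i, hi⟩ : Fin n) : ℕ) from rfl, hcoeff]
      simp only [hc]
      split_ifs <;> simp
    · exact Or.inr (Or.inl (coeff_eq_zero_of_degree_lt
        (hdeg.trans_le (by exact_mod_cast not_lt.1 hi))))
  · intro h0
    refine h (funext fun j => ?_)
    have h1 := hcoeff j
    rw [h0, coeff_zero] at h1
    simp only [hc] at h1
    cases hs : s j <;> cases hs' : s' j <;> simp [hs, hs'] at h1 ⊢
  · have h1 : signSum n x s - signSum n x s' = 2 * aeval x Q := by
      rw [signSum, signSum, ← Finset.sum_sub_distrib, hQ, map_sum, Finset.mul_sum]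
      refine Finset.sum_congr rfl fun j _ => ?_
      simp only [hc, coinSign, map_mul, map_pow, aeval_X, aeval_C]
      cases s j <;> cases s' j <;> norm_num <;> ring
    have h2 : aeval (x : ℂ) Q = ((aeval x Q : ℝ) : ℂ) := by
      have := aeval_algebraMap_apply ℂ x Q
      simpa using this
    rw [h1, h2, Complex.norm_real, Real.norm_eq_abs, abs_mul, abs_two]

end

theorem theorem3p2 :
    ∀ ε : ℝ, 0 < ε → ∃ c : ℝ, 0 < c ∧ ∃ N : ℕ, ∀ n : ℕ, N ≤ n →
      ∀ lam : ℝ, 0 < lam → lam ≤ 1 - ε →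
      ∀ η : ℂ, η ≠ 0 →
        (∃ P ∈ signPolynomials n, P ≠ 0 ∧ Polynomial.aeval η P = 0) →
        ‖(lam : ℂ) - η‖ < (n : ℝ) ^ (-(4 * (n : ℤ))) →
        ∀ r : ℝ, 0 < r → r ≤ ‖(lam : ℂ) - η‖ ^ (1 / c) →
          entropyAtScale (bernoulliConvolution lam (Set.Ioc (lam ^ n) 1)) r = (n : ℝ≥0∞) := by
  intro ε hε
  rcases lt_or_ge ε 1 with hε1 | hε1
  swap
  -- For `ε ≥ 1` no positive `lam` is admissible.
  · exact ⟨1, one_pos, 0, fun n _ lam h0 h1 => absurd h0 (by linarith)⟩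
  obtain ⟨K, N, hKN⟩ := exists_norm_pow_le_norm_aeval hε hε1
  refine ⟨1 / ((K + 1 : ℕ) : ℝ), by positivity, max N 1,
    fun n hn lam h0 h1 η hη hP hδ r hr hrδ => ?_⟩
  have hn0 : (0 : ℝ) < n := by exact_mod_cast (le_max_right N 1).trans hn
  refine entropyAtScale_eq_of_separated h0 (by linarith) hr n fun s s' hss => ?_
  obtain ⟨Q, hQ, hQ0, hQs⟩ := exists_signPolynomial_of_ne lam hss
  have hδ' : ‖(lam : ℂ) - η‖ * (n : ℝ) ^ (4 * n) < 1 := by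
    rw [zpow_neg, ← one_div, lt_div_iff₀ (by positivity)] at hδ
    exact_mod_cast hδ
  have h2 := hKN n ((le_max_left _ _).trans hn) lam h0 h1 η hη hP hδ' Q hQ hQ0
  rw [one_div_one_div, Real.rpow_natCast] at hrδ
  rw [hQs]
  linarith [norm_nonneg (Polynomial.aeval (lam : ℂ) Q)]
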